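/- Let $R$ be an integral domain with quotient field $K$, $R\neq K$. For a nonzero $R$-submodule $E$ of $K$ put $(R:E)=\{x\in K: xE\subseteq R\}$, $E_v=(R:(R:E))$ and $E_t=\bigcup F_v$, the union being over all finitely generated $R$-submodules $F\subseteq E$. A nonzero ideal $I$ of $R$ is \emph{divisorial} if $I_v=I$, a \emph{$t$-ideal} if $I_t=I$, and \emph{$v$-finite} if $I_v=F_v$ for some nonzero finitely generated fractional ideal $F$. A \emph{$t$-prime} is a prime $t$-ideal, and a \emph{$t$-maximal} ideal is an ideal maximal among the proper $t$-ideals (such an ideal is prime). The \emph{minimal $t$-primes} of an ideal are the minimal elements of the set of $t$-primes containing it. A prime $P$ is \emph{branched} if there is a $P$-primary ideal different from $P$. An ideal is \emph{strong} if it is the trace of some $R$-module $M$, i.e. the ideal generated by all $f(m)$ with $f\in\operatorname{Hom}_R(M,R)$, $m\in M$. The domain $R$ is a \emph{$tRTP$-domain} if every proper strong $t$-ideal of $R$ is a radical ideal, and a \emph{P$v$MD} if $R_M$ is a valuation domain for every $t$-maximal ideal $M$. Theorem. Let $R$ be a P$v$MD (not a field). The following conditions are equivalent: (i) $R$ is a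 $tRTP$-domain; (ii) each branched $t$-prime $P$ contains a finitely generated ideal $J$ such that $J\nsubseteq M$ for each $t$-maximal ideal $M$ not containing $P$; (iii) each branched $t$-prime is the radical of a $v$-finite divisorial ideal; (iv) each nonzero principal ideal of $R$ has at most finitely many minimal primes; or, equivalently, at most finitely many minimal $t$-primes; (v) each nonzero finitely generated ideal of $R$ has at most finitely many minimal $t$-primes; (vi) each $v$-finite divisorial ideal of $R$ has at most finitely many minimal primes; or, equivalently, at most finitely many minimal $t$-primes. -/

import Mathlib

/-! Star operations on an integral domain `R` with quotient field `K`.  Fractional ideals are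
regarded as `R`-submodules of `K`; the quotient `I / J` of submodules of `K` is
`(I : J) = {x ∈ K | x J ⊆ I}`, and `1` is `R` itself as a submodule of `K`. -/

namespace TStar

universe u v

section Closures

variable {R : Type u} [CommRing R] {K : Type v} [Field K] [Algebra R K]

/-- The divisorial closure `E_v = (R : (R : E))`. -/
def vClosure (E : Submodule R K) : Submodule R K :=
  1 / (1 / E)

theorem vClosure_mono {E F : Submodule R K} (h : E ≤ F) : vClosure E ≤ vClosure F := by
  intro x hx
  rw [vClosure, Submodule.mem_div_iff_forall_mul_mem] at hx ⊢
  intro y hy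
  apply hx
  rw [Submodule.mem_div_iff_forall_mul_mem] at hy ⊢
  exact fun z hz => hy z (h hz)

/-- The `t`-closure `E_t`: the union of the `F_v` over all finitely generated `F ⊆ E`. -/
def tClosure (E : Submodule R K) : Submodule R K where
  carrier := {x | ∃ F : Submodule R K, F.FG ∧ F ≤ E ∧ x ∈ vClosure F}
  zero_mem' := ⟨⊥, Submodule.fg_bot, bot_le, Submodule.zero_mem _⟩
  add_mem' := by
    rintro x y ⟨F, hF, hFE, hx⟩ ⟨G, hG, hGE, hy⟩
    exact ⟨F ⊔ G, hF.sup hG, sup_le hFE hGE,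
      Submodule.add_mem _ (vClosure_mono le_sup_left hx) (vClosure_mono le_sup_right hy)⟩
  smul_mem' := by
    rintro c x ⟨F, hF, hFE, hx⟩
    exact ⟨F, hF, hFE, Submodule.smul_mem _ c hx⟩

end Closures

section Ideals

variable {R : Type u} [CommRing R] (K : Type v) [Field K] [Algebra R K]

/-- A (nonzero, integral) divisorial ideal, i.e. `I = I_v`. -/
def IsDivisorial (I : Ideal R) : Prop :=
  I ≠ ⊥ ∧ vClosure (IsLocalization.coeSubmodule K I) = IsLocalization.coeSubmodule K I

/-- `I` is `v`-finite: `I_v = F_v` for some nonzero finitely generated fractional ideal `F`. -/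
def IsVFinite (I : Ideal R) : Prop :=
  ∃ F : Submodule R K, F ≠ ⊥ ∧ F.FG ∧ vClosure (IsLocalization.coeSubmodule K I) = vClosure F

/-- A (nonzero, integral) `t`-ideal, i.e. `I = I_t`. -/
def IsTIdeal (I : Ideal R) : Prop :=
  I ≠ ⊥ ∧ tClosure (IsLocalization.coeSubmodule K I) = IsLocalization.coeSubmodule K I

/-- A `t`-prime: a prime `t`-ideal. -/
def IsTPrime (P : Ideal R) : Prop :=
  P.IsPrime ∧ IsTIdeal K P

/-- A `t`-maximal ideal: an ideal maximal among the proper `t`-ideals. -/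
def IsTMaximal (M : Ideal R) : Prop :=
  Maximal (fun I : Ideal R => IsTIdeal K I ∧ I ≠ ⊤) M

/-- The minimal `t`-primes of an ideal `J`: the minimal elements of the set of `t`-primes that
contain `J`. -/
def minimalTPrimes (J : Ideal R) : Set (Ideal R) :=
  {P | Minimal (fun Q : Ideal R => IsTPrime K Q ∧ J ≤ Q) P}

end Ideals

section Rings

variable (R : Type u) [CommRing R]

/-- The trace of an `R`-module `M`: the ideal generated by all the values `f m` of linear forms
`f : M → R`. -/
def traceIdeal (M : Type u) [AddCommGroup M] [Module R M] : Ideal R :=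
  Ideal.span {r | ∃ (f : M →ₗ[R] R) (m : M), f m = r}

variable {R}

/-- A strong ideal (or trace ideal) is the trace of some `R`-module.  Modules in the universe of
`R` suffice, because a trace ideal is also the trace of itself as a module. -/
def IsStrong (J : Ideal R) : Prop :=
  ∃ (M : Type u) (_ : AddCommGroup M) (_ : Module R M), J = traceIdeal R M

/-- A prime ideal `P` is branched if there is a `P`-primary ideal different from `P`. -/
def IsBranched (P : Ideal R) : Prop :=
  P.IsPrime ∧ ∃ Q : Ideal R, Q.IsPrimary ∧ Q.radical = P ∧ Q ≠ P

variable (R) (K : Type v) [Field K] [Algebra R K]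

/-- A Prüfer `v`-multiplication domain: the localization at every `t`-maximal ideal is a valuation
domain.  (A `t`-maximal ideal is always prime; the prime hypothesis is only there to form the
localization.) -/
def IsPvMD [IsDomain R] : Prop :=
  ∀ (M : Ideal R) [M.IsPrime], IsTMaximal K M → ValuationRing (Localization.AtPrime M)

/-- The `t`-radical trace property: every proper strong `t`-ideal is a radical ideal. -/
def IsTRTP : Prop :=
  ∀ J : Ideal R, J ≠ ⊤ → IsStrong J → IsTIdeal K J → J.IsRadical

end Rings

end TStar

/-!
For a P`v`MD `R` everything is expressed inside `R`. The closures of integral ideals are described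
by divisibility (`idealV`, `idealT`, `IsTClosed`; they agree with the closures in `K` by
`vClosure_coeSubmodule` and `isTIdeal_iff`), and the hypothesis on the localizations becomes: of
any two elements, one divides the other up to a factor outside a given `t`-maximal ideal
(`IsLocVal`). Three tools carry the argument. Divisibility may be tested locally at the
`t`-maximal ideals (`dvd_of_forall_isTMax`); a `t`-ideal contains a finite product of members of a
family of finitely generated ideals as soon as each prime `t`-ideal above it contains a member
(`exists_mem_closure_le`); and the branched prime `t`-ideals are exactly those that are minimal
over a nonzero principal ideal (`IsBranched.exists_mem_minimalPrimes`,
`isBranched_of_mem_minimalPrimes`).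

A strong ideal `J` is one that each fraction multiplying `J` into `R` multiplies into `J`. Let `P`
be a branched prime `t`-ideal that no finitely generated subideal cuts out among the `t`-maximal
ideals. As ideals `(d R : c)` are `v`-finite (`exists_fg_le_colon`), each fraction lying in all
`R_M` with `M` `t`-maximal and `P ⊄ M` lies in `R_P`. This makes the `P`-primary ideal
`a² R_P ∩ R` strong, where `P` is minimal over `a`, contrary to the trace property
(`isTSupportFG_of_trace`). Conversely, if each branched prime `t`-ideal is cut out by a finitely
generated ideal, this ideal serves to construct fractions that multiply a strong `t`-ideal into
`R` but, if the ideal is not radical, not into itself (`isRadical_of_isTSupportFG`).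

If `P` is cut out by `J` and minimal over `a`, it is the radical of `(J + a R)_v`
(`IsTSupportFG.exists_radical_eq`). If all minimal primes of `x` are radicals of `v`-finite
divisorial ideals, then `x R` contains a finite product of finitely generated ideals defining
some of them, and every minimal prime of `x` is among these finitely many
(`finite_tMinimalPrimes_of_radical`). If `a` has only finitely many minimal primes, `P` can be
separated from each of the others by a finitely generated ideal (`isTSupportFG_of_finite`).
Finally, minimal primes of `t`-ideals are `t`-ideals (`isTClosed_of_mem_minimalPrimes`), and
finitely generated ideals are locally principal (`finite_tMinimalPrimes_of_fg`), which links the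
finiteness conditions.
-/

namespace TStar

variable {R : Type*} [CommRing R]

/-! ### Closures of integral ideals -/

/-- The divisorial closure of an integral ideal `F`, computed inside `R`: an element `x` belongs
to it when every fraction `c / d` that multiplies `F` into `R` also multiplies `x` into `R`. -/
def idealV (F : Ideal R) : Ideal R where
  carrier := {x | ∀ c d : R, d ≠ 0 → (∀ f ∈ F, d ∣ c * f) → d ∣ c * x}
  zero_mem' := fun c d _ _ => by simp
  add_mem' := fun hx hy c d hd h => by
    rw [mul_add]
    exact dvd_add (hx c d hd h) (hy c d hd h)
  smul_mem' := fun r x hx c d hd h => by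
    rw [smul_eq_mul, mul_left_comm]
    exact (hx c d hd h).mul_left r

theorem mem_idealV {F : Ideal R} {x : R} :
    x ∈ idealV F ↔ ∀ c d : R, d ≠ 0 → (∀ f ∈ F, d ∣ c * f) → d ∣ c * x :=
  Iff.rfl

theorem le_idealV (F : Ideal R) : F ≤ idealV F :=
  fun x hx _ _ _ h => h x hx

theorem idealV_mono {F G : Ideal R} (h : F ≤ G) : idealV F ≤ idealV G :=
  fun _ hx c d hd hG => hx c d hd fun f hf => hG f (h hf)

theorem idealV_idem (F : Ideal R) : idealV (idealV F) = idealV F :=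
  le_antisymm (fun _ hx c d hd h => hx c d hd fun _ hy => hy c d hd h) (le_idealV _)

theorem idealV_ne_bot {F : Ideal R} (h : F ≠ ⊥) : idealV F ≠ ⊥ :=
  fun h' => h (le_bot_iff.1 ((le_idealV F).trans h'.le))

/-- The notion of a `t`-ideal expressed inside `R`: a nonzero ideal that contains the divisorial
closure of each of its finitely generated subideals. -/
def IsTClosed (I : Ideal R) : Prop :=
  I ≠ ⊥ ∧ ∀ F : Ideal R, F.FG → F ≤ I → idealV F ≤ I

theorem isTClosed_idealV {F : Ideal R} (h : F ≠ ⊥) : IsTClosed (idealV F) :=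
  ⟨idealV_ne_bot h, fun _ _ hG => (idealV_mono hG).trans (idealV_idem F).le⟩

/-- The `t`-closure of an integral ideal, computed inside `R`. -/
def idealT (I : Ideal R) : Ideal R where
  carrier := {x | ∃ F : Ideal R, F.FG ∧ F ≤ I ∧ x ∈ idealV F}
  zero_mem' := ⟨⊥, Submodule.fg_bot, bot_le, Submodule.zero_mem _⟩
  add_mem' := by
    rintro x y ⟨F, hF, hFE, hx⟩ ⟨G, hG, hGE, hy⟩
    exact ⟨F ⊔ G, Submodule.FG.sup hF hG, sup_le hFE hGE,
      Submodule.add_mem _ (idealV_mono le_sup_left hx) (idealV_mono le_sup_right hy)⟩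
  smul_mem' := by
    rintro c x ⟨F, hF, hFE, hx⟩
    exact ⟨F, hF, hFE, Submodule.smul_mem _ c hx⟩

theorem le_idealT (I : Ideal R) : I ≤ idealT I := fun x hx =>
  ⟨Ideal.span {x}, Submodule.fg_span_singleton x, (Ideal.span_singleton_le_iff_mem I).2 hx,
    le_idealV _ (Ideal.mem_span_singleton_self x)⟩

theorem exists_fg_le_idealV_of_le_idealT {I F : Ideal R} (hF : F.FG) (h : F ≤ idealT I) :
    ∃ G : Ideal R, G.FG ∧ G ≤ I ∧ F ≤ idealV G := by
  induction F, hF using Submodule.fg_induction with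
  | singleton x =>
    obtain ⟨G, hG, hGI, hx⟩ := h (Ideal.mem_span_singleton_self x)
    exact ⟨G, hG, hGI, (Ideal.span_singleton_le_iff_mem _).2 hx⟩
  | sup N₁ N₂ _ _ h₁ h₂ =>
    obtain ⟨G₁, hG₁, hI₁, hN₁⟩ := h₁ (le_sup_left.trans h)
    obtain ⟨G₂, hG₂, hI₂, hN₂⟩ := h₂ (le_sup_right.trans h)
    exact ⟨G₁ ⊔ G₂, Submodule.FG.sup hG₁ hG₂, sup_le hI₁ hI₂,
      sup_le (hN₁.trans (idealV_mono le_sup_left)) (hN₂.trans (idealV_mono le_sup_right))⟩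

theorem isTClosed_idealT {I : Ideal R} (h : I ≠ ⊥) : IsTClosed (idealT I) := by
  refine ⟨fun h' => h (le_bot_iff.1 ((le_idealT I).trans h'.le)), fun F hF hFI x hx => ?_⟩
  obtain ⟨G, hG, hGI, hFG⟩ := exists_fg_le_idealV_of_le_idealT hF hFI
  exact ⟨G, hG, hGI, idealV_idem G ▸ idealV_mono hFG hx⟩

theorem IsTClosed.colon {T : Ideal R} (hT : IsTClosed T) (S : Set R) :
    IsTClosed (Submodule.colon T S) := by
  refine ⟨fun h => hT.1 (le_bot_iff.1 (Ideal.le_colon.trans h.le)), fun F hF hFT x hx => ?_⟩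
  rw [Submodule.mem_colon]
  intro g hg
  have hle : Ideal.span {g} * F ≤ T := by
    rw [Ideal.span_singleton_mul_le_iff]
    intro f hf
    rw [mul_comm]
    exact Submodule.mem_colon.1 (hFT hf) g hg
  refine hT.2 _ ((Submodule.fg_span_singleton g).mul hF) hle fun c d hd h => ?_
  rw [smul_eq_mul, mul_comm x, ← mul_assoc]
  refine hx _ d hd fun f hf => ?_
  rw [mul_assoc]
  exact h _ (Ideal.mul_mem_mul (Ideal.mem_span_singleton_self g) hf)

theorem isTClosed_sSup {C : Set (Ideal R)} (hne : C.Nonempty) (hC : IsChain (· ≤ ·) C)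
    (h : ∀ T ∈ C, IsTClosed T) : IsTClosed (sSup C) := by
  obtain ⟨T₀, hT₀⟩ := hne
  refine ⟨fun h' => (h T₀ hT₀).1 (le_bot_iff.1 ((le_sSup hT₀).trans h'.le)), fun F hF hFC => ?_⟩
  obtain ⟨T, hT, hFT⟩ := (CompleteLattice.isCompactElement_iff_le_of_directed_sSup_le _ _).1
    ((Submodule.fg_iff_compact F).1 hF) C ⟨T₀, hT₀⟩ hC.directedOn hFC
  exact ((h T hT).2 F hF hFT).trans (le_sSup hT)

theorem idealV_span_singleton {d : R} (hd : d ≠ 0) : idealV (Ideal.span {d}) = Ideal.span {d} := by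
  refine le_antisymm (fun x hx => ?_) (le_idealV _)
  have := hx 1 d hd fun f hf => by simpa using Ideal.mem_span_singleton.1 hf
  exact Ideal.mem_span_singleton.2 (by simpa using this)

theorem isTClosed_span_singleton {d : R} (hd : d ≠ 0) : IsTClosed (Ideal.span {d}) :=
  idealV_span_singleton hd ▸ isTClosed_idealV (by simpa using hd)

/-! ### Existence of prime `t`-ideals -/

/-- The ideals that are maximal among the `t`-ideals containing no member of a multiplicative set
of ideals are prime, since quotients `(T : U)` of a `t`-ideal `T` are `t`-ideals. -/
theorem isPrime_of_maximal_isTClosed {S : Submonoid (Ideal R)} {T : Ideal R}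
    (hT : Maximal (fun T : Ideal R => IsTClosed T ∧ ∀ G ∈ S, ¬ G ≤ T) T) : T.IsPrime := by
  have key : ∀ {U : Set R} {a : R}, a ∈ Submodule.colon T U → a ∉ T →
      ∃ G ∈ S, G ≤ Submodule.colon T U := by
    intro U a ha haT
    by_contra! h
    exact haT (hT.2 ⟨hT.1.1.colon U, h⟩ Ideal.le_colon ha)
  refine ⟨fun h => hT.1.2 1 S.one_mem (h ▸ le_top), fun {a b} hab => ?_⟩
  by_contra! hcon
  obtain ⟨G₁, hG₁, h₁⟩ := key (U := {b}) (a := a) (by simpa using hab) hcon.1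
  obtain ⟨G₂, hG₂, h₂⟩ := key (U := G₁) (a := b)
    (Submodule.mem_colon.2 fun g hg => by
      simpa [mul_comm] using h₁ hg) hcon.2
  refine hT.1.2 _ (S.mul_mem hG₂ hG₁) (Ideal.mul_le.2 fun r hr s hs => ?_)
  exact Submodule.mem_colon.1 (h₂ hr) s hs

/-- A `t`-ideal that contains no member of a multiplicative set of finitely generated ideals can
be enlarged to a maximal one. -/
theorem exists_maximal_isTClosed {S : Submonoid (Ideal R)} (hS : ∀ G ∈ S, G.FG) {I : Ideal R}
    (hI : IsTClosed I) (h : ∀ G ∈ S, ¬ G ≤ I) :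
    ∃ T, I ≤ T ∧ Maximal (fun T : Ideal R => IsTClosed T ∧ ∀ G ∈ S, ¬ G ≤ T) T := by
  refine zorn_le_nonempty₀ {T : Ideal R | IsTClosed T ∧ ∀ G ∈ S, ¬ G ≤ T}
    (fun C hCS hC T hT => ⟨sSup C, ⟨isTClosed_sSup ⟨T, hT⟩ hC fun U hU => (hCS hU).1,
      fun G hG hGC => ?_⟩, fun U hU => le_sSup hU⟩) I ⟨hI, h⟩
  obtain ⟨U, hU, hGU⟩ := (CompleteLattice.isCompactElement_iff_le_of_directed_sSup_le _ _).1
    ((Submodule.fg_iff_compact G).1 (hS G hG)) C ⟨T, hT⟩ hC.directedOn hGC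
  exact (hCS hU).2 G hG hGU

/-- If every prime `t`-ideal above the `t`-ideal `I` contains a member of the family `𝓕` of
finitely generated ideals, then `I` contains a finite product of members of `𝓕`. -/
theorem exists_mem_closure_le {𝓕 : Set (Ideal R)} (h𝓕 : ∀ F ∈ 𝓕, F.FG) {I : Ideal R}
    (hI : IsTClosed I)
    (h : ∀ Q : Ideal R, Q.IsPrime → IsTClosed Q → I ≤ Q → ∃ F ∈ 𝓕, F ≤ Q) :
    ∃ G ∈ Submonoid.closure 𝓕, G ≤ I := by
  by_contra! hcon
  have hfg : ∀ G ∈ Submonoid.closure 𝓕, G.FG := fun G hG => by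
    induction hG using Submonoid.closure_induction with
    | mem F hF => exact h𝓕 F hF
    | one => exact ⟨{1}, by simp⟩
    | mul F G _ _ hF hG => exact hF.mul hG
  obtain ⟨Q, hIQ, hQ⟩ := exists_maximal_isTClosed hfg hI hcon
  obtain ⟨F, hF, hFQ⟩ := h Q (isPrime_of_maximal_isTClosed hQ) hQ.1.1 hIQ
  exact hQ.1.2 F (Submonoid.subset_closure hF) hFQ

/-- An ideal maximal among the proper `t`-ideals, with `t`-ideals expressed inside `R`. -/
def IsTMax (M : Ideal R) : Prop :=
  Maximal (fun I : Ideal R => IsTClosed I ∧ I ≠ ⊤) M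

theorem isTMax_iff {M : Ideal R} : IsTMax M ↔
    Maximal (fun T : Ideal R => IsTClosed T ∧ ∀ G ∈ (⊥ : Submonoid (Ideal R)), ¬ G ≤ T) M := by
  simp [IsTMax]

theorem IsTMax.isPrime {M : Ideal R} (hM : IsTMax M) : M.IsPrime :=
  isPrime_of_maximal_isTClosed (isTMax_iff.1 hM)

theorem exists_isTMax_ge {I : Ideal R} (hI : IsTClosed I) (h : I ≠ ⊤) :
    ∃ M, IsTMax M ∧ I ≤ M := by
  obtain ⟨M, hIM, hM⟩ := exists_maximal_isTClosed (S := ⊥) (I := I)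
    (fun G hG => by rw [Submonoid.mem_bot.1 hG]; exact ⟨{1}, by simp⟩) hI (by simpa using h)
  exact ⟨M, isTMax_iff.2 hM, hIM⟩

/-- An ideal contained in no `t`-maximal ideal has a finitely generated subideal with the same
property: its `t`-closure is `R`. -/
theorem exists_fg_le_not_le_isTMax {I : Ideal R} (hI : I ≠ ⊥) (h : ∀ M, IsTMax M → ¬ I ≤ M) :
    ∃ F : Ideal R, F.FG ∧ F ≤ I ∧ ∀ M, IsTMax M → ¬ F ≤ M := by
  have htop : idealT I = ⊤ := by
    by_contra hne
    obtain ⟨M, hM, hIM⟩ := exists_isTMax_ge (isTClosed_idealT hI) hne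
    exact h M hM ((le_idealT I).trans hIM)
  obtain ⟨F, hF, hFI, h1⟩ : (1 : R) ∈ idealT I := htop ▸ Submodule.mem_top
  refine ⟨F, hF, hFI, fun M hM hFM => hM.1.2 ?_⟩
  exact (Ideal.eq_top_iff_one M).2 (hM.1.1.2 F hF hFM h1)

/-- Divisibility may be tested locally at the `t`-maximal ideals. -/
theorem dvd_of_forall_isTMax {d x : R} (hd : d ≠ 0)
    (h : ∀ N, IsTMax N → ∃ u ∉ N, d ∣ u * x) : d ∣ x := by
  by_contra hdx
  obtain ⟨N, hN, hle⟩ := exists_isTMax_ge ((isTClosed_span_singleton hd).colon {x})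
    (by simpa [Ideal.mem_span_singleton] using hdx)
  obtain ⟨u, hu, hux⟩ := h N hN
  exact hu (hle (by simpa [Ideal.mem_span_singleton] using hux))

theorem isTClosed_of_mem_minimalPrimes {I P : Ideal R} (hI : IsTClosed I)
    (hP : P ∈ I.minimalPrimes) : IsTClosed P := by
  have := hP.isPrime
  by_contra hcon
  -- Otherwise no prime `t`-ideal above `I` is contained in `P`, so that `I` contains a product of
  -- elements outside `P`.
  obtain ⟨G, hG, hGI⟩ := exists_mem_closure_le (𝓕 := {F | ∃ s ∉ P, F = Ideal.span {s}})
    (by rintro _ ⟨s, _, rfl⟩; exact Submodule.fg_span_singleton s) hI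
    (fun Q hQ hQT hIQ => by
      have hQP : ¬ Q ≤ P := fun hle => hcon (le_antisymm hle (hP.2 ⟨hQ, hIQ⟩ hle) ▸ hQT)
      obtain ⟨s, hsQ, hsP⟩ := SetLike.not_le_iff_exists.1 hQP
      exact ⟨_, ⟨s, hsP, rfl⟩, (Ideal.span_singleton_le_iff_mem Q).2 hsQ⟩)
  have hnot : ¬ G ≤ P := by
    clear hGI
    induction hG using Submonoid.closure_induction with
    | mem F hF =>
      obtain ⟨s, hs, rfl⟩ := hF
      rwa [Ideal.span_singleton_le_iff_mem]
    | one => simpa using this.ne_top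
    | mul F G _ _ hF hG => rw [this.mul_le]; tauto
  exact hnot (hGI.trans hP.le)

/-- The minimal elements of the set of prime `t`-ideals that contain `J`. -/
def tMinimalPrimes (J : Ideal R) : Set (Ideal R) :=
  {P | Minimal (fun Q : Ideal R => (Q.IsPrime ∧ IsTClosed Q) ∧ J ≤ Q) P}

theorem tMinimalPrimes_eq_minimalPrimes {I : Ideal R} (hI : IsTClosed I) :
    tMinimalPrimes I = I.minimalPrimes := by
  ext P
  constructor
  · rintro ⟨⟨⟨hP, -⟩, hIP⟩, hmin⟩
    obtain ⟨Q, hQ, hQP⟩ := Ideal.exists_minimalPrimes_le hIP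
    have := hmin ⟨⟨hQ.isPrime, isTClosed_of_mem_minimalPrimes hI hQ⟩, hQ.le⟩ hQP
    exact le_antisymm hQP this ▸ hQ
  · exact fun hP => ⟨⟨⟨hP.isPrime, isTClosed_of_mem_minimalPrimes hI hP⟩, hP.le⟩,
      fun Q hQ hQP => hP.2 ⟨hQ.1.1, hQ.2⟩ hQP⟩

theorem tMinimalPrimes_idealV {F : Ideal R} (hF : F.FG) :
    tMinimalPrimes (idealV F) = tMinimalPrimes F := by
  have : (fun Q : Ideal R => (Q.IsPrime ∧ IsTClosed Q) ∧ idealV F ≤ Q) =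
      fun Q : Ideal R => (Q.IsPrime ∧ IsTClosed Q) ∧ F ≤ Q :=
    funext fun Q => propext (and_congr_right fun hQ =>
      ⟨(le_idealV F).trans, hQ.2.2 F hF⟩)
  rw [tMinimalPrimes, this, tMinimalPrimes]

/-! ### Primes with a valuation ring as localization -/

/-- The localization of `R` at the prime ideal `P` is a valuation ring, expressed inside `R`: of
any two elements, one divides the other up to a factor outside `P`. -/
def IsLocVal (P : Ideal R) : Prop :=
  ∀ a b : R, ∃ s ∉ P, b ∣ s * a ∨ a ∣ s * b

theorem isLocVal_of_valuationRing [IsDomain R] {P : Ideal R} [P.IsPrime]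
    [ValuationRing (Localization.AtPrime P)] : IsLocVal P := by
  have key : ∀ (a b : R) (c : Localization.AtPrime P),
      algebraMap R _ a * c = algebraMap R _ b → ∃ s ∉ P, a ∣ s * b := by
    intro a b c h
    obtain ⟨r, s, rfl⟩ := IsLocalization.exists_mk'_eq P.primeCompl c
    rw [← IsLocalization.mk'_one (M := P.primeCompl) (Localization.AtPrime P) a,
      ← IsLocalization.mk'_one (M := P.primeCompl) (Localization.AtPrime P) b,
      ← IsLocalization.mk'_mul, IsLocalization.mk'_eq_iff_eq, ] at h
    have h' := IsLocalization.injective (Localization.AtPrime P)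
      P.primeCompl_le_nonZeroDivisors h
    exact ⟨s, s.2, r, by simpa using h'.symm⟩
  intro a b
  obtain ⟨c, hc | hc⟩ := ValuationRing.cond (algebraMap R (Localization.AtPrime P) a)
    (algebraMap R (Localization.AtPrime P) b)
  · obtain ⟨s, hs, h⟩ := key a b c hc
    exact ⟨s, hs, Or.inr h⟩
  · obtain ⟨s, hs, h⟩ := key b a c hc
    exact ⟨s, hs, Or.inl h⟩

theorem IsLocVal.mono {P Q : Ideal R} (h : IsLocVal Q) (hPQ : P ≤ Q) : IsLocVal P := fun a b =>
  let ⟨s, hs, hab⟩ := h a b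
  ⟨s, fun hP => hs (hPQ hP), hab⟩

/-- The primes contained in a prime whose localization is a valuation ring form a chain. -/
theorem IsLocVal.le_total {M P Q : Ideal R} (h : IsLocVal M) [hP : P.IsPrime] [hQ : Q.IsPrime]
    (hPM : P ≤ M) (hQM : Q ≤ M) : P ≤ Q ∨ Q ≤ P := by
  by_contra! hcon
  obtain ⟨a, haP, haQ⟩ := SetLike.not_le_iff_exists.1 hcon.1
  obtain ⟨b, hbQ, hbP⟩ := SetLike.not_le_iff_exists.1 hcon.2
  obtain ⟨s, hs, hab | hab⟩ := h a b
  · exact (hQ.mem_or_mem (Q.mem_of_dvd hab hbQ)).elim (fun h => hs (hQM h)) haQ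
  · exact (hP.mem_or_mem (P.mem_of_dvd hab haP)).elim (fun h => hs (hPM h)) hbP

/-- A finitely generated ideal is locally generated by one of its given generators. -/
theorem IsLocVal.exists_generator {P : Ideal R} [hP : P.IsPrime] (h : IsLocVal P) {S : Finset R}
    (hS : S.Nonempty) : ∃ q ∈ S, ∃ s ∉ P, ∀ i ∈ Ideal.span (S : Set R), q ∣ s * i := by
  suffices ∃ q ∈ S, ∃ s ∉ P, ∀ i ∈ S, q ∣ s * i by
    obtain ⟨q, hq, s, hs, hi⟩ := this
    refine ⟨q, hq, s, hs, fun i hi' => ?_⟩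
    have : Ideal.span (S : Set R) ≤ (Ideal.span {q}).colon {s} :=
      Ideal.span_le.2 fun j hj => by
        simpa [Ideal.mem_span_singleton, mul_comm] using hi j hj
    simpa [Ideal.mem_span_singleton, mul_comm] using this hi'
  induction hS using Finset.Nonempty.cons_induction with
  | singleton a => exact ⟨a, by simp, 1, hP.one_notMem, by simp⟩
  | cons a S ha hS ih =>
    obtain ⟨q, hq, s, hs, hi⟩ := ih
    obtain ⟨t, ht, hd | hd⟩ := h q a
    · refine ⟨a, by simp, t * s, fun hts => (hP.mem_or_mem hts).elim ht hs, fun i hiS => ?_⟩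
      rcases Finset.mem_cons.1 hiS with rfl | hiS
      · exact dvd_mul_left _ _
      · rw [mul_assoc]
        exact hd.trans (mul_dvd_mul_left t (hi i hiS))
    · refine ⟨q, by simp [hq], t * s, fun hts => (hP.mem_or_mem hts).elim ht hs, fun i hiS => ?_⟩
      rcases Finset.mem_cons.1 hiS with rfl | hiS
      · rw [mul_right_comm]
        exact hd.mul_right s
      · rw [mul_assoc]
        exact (hi i hiS).mul_left t

/-- A finitely generated ideal is locally principal. -/
theorem IsLocVal.exists_generator_of_fg {P : Ideal R} [hP : P.IsPrime] (h : IsLocVal P)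
    {I : Ideal R} (hI : I.FG) : ∃ q ∈ I, ∃ s ∉ P, ∀ i ∈ I, q ∣ s * i := by
  obtain ⟨S, rfl⟩ := hI
  rcases S.eq_empty_or_nonempty with rfl | hS
  · exact ⟨0, by simp, 1, hP.one_notMem, by simp⟩
  · obtain ⟨q, hq, h⟩ := h.exists_generator hS
    exact ⟨q, Ideal.subset_span hq, h⟩

/-! ### Branched primes -/

theorem exists_mul_pow_mem_of_mem_minimalPrimes {I P : Ideal R} (hP : P ∈ I.minimalPrimes) {b : R}
    (hb : b ∈ P) : ∃ s ∉ P, ∃ n : ℕ, s * b ^ n ∈ I := by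
  have := hP.isPrime
  by_contra! hcon
  have hdisj : Disjoint (I : Set R) (P.primeCompl ⊔ Submonoid.powers b : Submonoid R) := by
    rw [Set.disjoint_left]
    intro x hx hxS
    obtain ⟨s, hs, _, ⟨n, rfl⟩, rfl⟩ := Submonoid.mem_sup.1 hxS
    exact hcon s hs n hx
  obtain ⟨Q, hQ, hIQ, hQd⟩ := Ideal.exists_le_prime_disjoint _ _ hdisj
  have hQP : Q ≤ P := fun x hx => by
    by_contra hxP
    exact Set.disjoint_left.1 hQd hx (le_sup_left (a := P.primeCompl) hxP)
  exact Set.disjoint_left.1 hQd (hP.2 ⟨hQ, hIQ⟩ hQP hb)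
    (le_sup_right (a := P.primeCompl) (Submonoid.mem_powers b))

/-- The contraction `I R_P ∩ R` of the localization of `I` at the prime `P`. -/
def saturation (I P : Ideal R) [P.IsPrime] : Ideal R where
  carrier := {r | ∃ s ∉ P, s * r ∈ I}
  zero_mem' := ⟨1, ‹P.IsPrime›.one_notMem, by simp⟩
  add_mem' := by
    rintro x y ⟨s, hs, hx⟩ ⟨t, ht, hy⟩
    refine ⟨s * t, fun h => (‹P.IsPrime›.mem_or_mem h).elim hs ht, ?_⟩
    rw [show s * t * (x + y) = t * (s * x) + s * (t * y) by ring]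
    exact I.add_mem (I.mul_mem_left t hx) (I.mul_mem_left s hy)
  smul_mem' := by
    rintro c x ⟨s, hs, hx⟩
    refine ⟨s, hs, ?_⟩
    rw [smul_eq_mul, mul_left_comm]
    exact I.mul_mem_left c hx

section Saturation

variable {I P : Ideal R} [hP : P.IsPrime]

theorem le_saturation : I ≤ saturation I P :=
  fun x hx => ⟨1, hP.one_notMem, by simpa using hx⟩

theorem saturation_le (h : I ≤ P) : saturation I P ≤ P := by
  rintro x ⟨s, hs, hx⟩
  exact (hP.mem_or_mem (h hx)).resolve_left hs

theorem mem_saturation_of_mul_mem {s x : R} (hs : s ∉ P) (h : s * x ∈ saturation I P) :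
    x ∈ saturation I P := by
  obtain ⟨t, ht, h⟩ := h
  exact ⟨t * s, fun h => (hP.mem_or_mem h).elim ht hs, by rwa [mul_assoc]⟩

theorem radical_saturation (h : P ∈ I.minimalPrimes) : (saturation I P).radical = P := by
  refine le_antisymm (hP.radical_le_iff.2 (saturation_le h.le)) fun b hb => ?_
  obtain ⟨s, hs, n, hn⟩ := exists_mul_pow_mem_of_mem_minimalPrimes h hb
  exact ⟨n, s, hs, hn⟩

theorem isPrimary_saturation (h : P ∈ I.minimalPrimes) : (saturation I P).IsPrimary := by
  refine Ideal.isPrimary_iff.2 ⟨fun h' => hP.ne_top (top_le_iff.1 (h' ▸ saturation_le h.le)),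
    fun {x y} hxy => or_iff_not_imp_right.2 fun hy => ?_⟩
  rw [radical_saturation h] at hy
  exact mem_saturation_of_mul_mem hy (mul_comm x y ▸ hxy)

theorem isTClosed_saturation (hI : IsTClosed I) : IsTClosed (saturation I P) := by
  refine ⟨fun h => hI.1 (le_bot_iff.1 (le_saturation.trans h.le)), fun F hF hFI => ?_⟩
  obtain ⟨s, hs, hsF⟩ : ∃ s ∉ P, F ≤ Submodule.colon I {s} := by
    induction F, hF using Submodule.fg_induction with
    | singleton x =>
      obtain ⟨s, hs, hx⟩ := hFI (Ideal.mem_span_singleton_self x)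
      exact ⟨s, hs, (Ideal.span_singleton_le_iff_mem _).2 (by simpa [mul_comm] using hx)⟩
    | sup N₁ N₂ _ _ h₁ h₂ =>
      obtain ⟨s, hs, hN₁⟩ := h₁ (le_sup_left.trans hFI)
      obtain ⟨t, ht, hN₂⟩ := h₂ (le_sup_right.trans hFI)
      refine ⟨s * t, fun h => (hP.mem_or_mem h).elim hs ht, sup_le (fun x hx => ?_) fun x hx => ?_⟩
      · have := I.mul_mem_right t (Submodule.mem_colon_singleton.1 (hN₁ hx))
        simpa [mul_assoc] using this
      · have := I.mul_mem_right s (Submodule.mem_colon_singleton.1 (hN₂ hx))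
        simpa [mul_assoc, mul_comm t] using this
  exact fun x hx => ⟨s, hs, by
    simpa [mul_comm] using (hI.colon {s}).2 F hF hsF hx⟩

end Saturation

theorem minimalPrimes_span_sq (a : R) :
    (Ideal.span {a ^ 2}).minimalPrimes = (Ideal.span {a}).minimalPrimes := by
  rw [← Ideal.radical_minimalPrimes, ← Ideal.span_singleton_pow,
    Ideal.radical_pow _ two_ne_zero, Ideal.radical_minimalPrimes]

/-- If `P` is minimal over `a`, then `a` is not in `a² R_P`. -/
theorem notMem_saturation_sq [IsDomain R] {P : Ideal R} [hP : P.IsPrime] {a : R} (ha : a ∈ P)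
    (ha0 : a ≠ 0) : a ∉ saturation (Ideal.span {a ^ 2}) P := by
  rintro ⟨s, hs, h⟩
  obtain ⟨k, hk⟩ := Ideal.mem_span_singleton.1 h
  have : s = a * k := mul_right_cancel₀ ha0 (by rw [hk]; ring)
  exact hs (this ▸ P.mul_mem_right k ha)

/-- A nonzero prime that is minimal over a principal ideal is branched. -/
theorem isBranched_of_mem_minimalPrimes [IsDomain R] {P : Ideal R} {a : R} (ha0 : a ≠ 0)
    (h : P ∈ (Ideal.span {a}).minimalPrimes) : IsBranched P := by
  have hP := h.isPrime
  have h2 := minimalPrimes_span_sq a ▸ h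
  refine ⟨hP, _, isPrimary_saturation h2, radical_saturation h2, fun heq => ?_⟩
  have haP : a ∈ P := h.le (Ideal.mem_span_singleton_self a)
  exact notMem_saturation_sq haP ha0 (heq.symm ▸ haP)

/-- A branched prime whose localization is a valuation ring is minimal over a principal ideal: if
`Q ≠ P` is `P`-primary and `a ∈ P` is not in `Q`, then `a` divides locally a power of each
element of `P`. -/
theorem IsBranched.exists_mem_minimalPrimes {P : Ideal R} (hP : IsBranched P) (h : IsLocVal P) :
    ∃ a, P ∈ (Ideal.span {a}).minimalPrimes := by
  obtain ⟨hprime, Q, hQ, hrad, hne⟩ := hP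
  have hQP : Q ≤ P := hrad ▸ Ideal.le_radical
  obtain ⟨a, haP, haQ⟩ := SetLike.not_le_iff_exists.1 fun h => hne (le_antisymm hQP h)
  refine ⟨a, ⟨hprime, (Ideal.span_singleton_le_iff_mem P).2 haP⟩, fun P' hP' hle b hb => ?_⟩
  have haP' := (Ideal.span_singleton_le_iff_mem P').1 hP'.2
  obtain ⟨n, hn⟩ := hrad.symm ▸ hb
  obtain ⟨s, hs, hd | hd⟩ := h a (b ^ n)
  · have hsa : a * s ∈ Q := mul_comm s a ▸ Q.mem_of_dvd hd hn
    exact absurd (((Ideal.isPrimary_iff.1 hQ).2 hsa).resolve_left haQ) (hrad.symm ▸ hs)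
  · exact hP'.1.mem_of_pow_mem n
      ((hP'.1.mem_or_mem (P'.mem_of_dvd hd haP')).resolve_left fun h => hs (hle h))

theorem isLocVal_of_isTClosed (hV : ∀ M : Ideal R, IsTMax M → IsLocVal M) {P : Ideal R}
    (hP : P.IsPrime) (hPT : IsTClosed P) : IsLocVal P :=
  let ⟨M, hM, hPM⟩ := exists_isTMax_ge hPT hP.ne_top
  (hV M hM).mono hPM

/-- The prime `P` is cut out, among the `t`-maximal ideals, by a finitely generated subideal: this
subideal is contained in the same `t`-maximal ideals as `P`. -/
def IsTSupportFG (P : Ideal R) : Prop :=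
  ∃ J : Ideal R, J.FG ∧ J ≤ P ∧ ∀ M : Ideal R, IsTMax M → ¬ P ≤ M → ¬ J ≤ M

/-! ### Strong ideals -/

theorem IsStrong.mem_of_linearMap {J : Ideal R} (hJ : IsStrong J) (f : J →ₗ[R] R) (j : J) :
    f j ∈ J := by
  obtain ⟨M, _, _, hM⟩ := hJ
  have hmem : ∀ (g : M →ₗ[R] R) (m : M), g m ∈ J := fun g m =>
    hM.ge (Ideal.subset_span ⟨g, m, rfl⟩)
  -- Composing with `f` maps linear forms on `M` to linear forms on `M`.
  suffices ∀ x, ∀ hx : x ∈ traceIdeal R M, ∀ hxJ : x ∈ J, f ⟨x, hxJ⟩ ∈ J from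
    this j (hM.le j.2) j.2
  intro x hx
  induction hx using Submodule.span_induction with
  | mem x h =>
    obtain ⟨g, m, rfl⟩ := h
    exact fun _ => hmem (f ∘ₗ g.codRestrict J (hmem g)) m
  | zero =>
    intro _
    have : f ⟨0, J.zero_mem⟩ = 0 := f.map_zero
    rw [this]
    exact J.zero_mem
  | add x y hx hy h₁ h₂ =>
    intro _
    have hxJ := hM.ge hx
    have hyJ := hM.ge hy
    have : f ⟨x + y, J.add_mem hxJ hyJ⟩ = f ⟨x, hxJ⟩ + f ⟨y, hyJ⟩ := f.map_add ⟨x, hxJ⟩ ⟨y, hyJ⟩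
    rw [this]
    exact J.add_mem (h₁ hxJ) (h₂ hyJ)
  | smul c x hx h =>
    intro _
    have hxJ := hM.ge hx
    have : f ⟨c • x, J.smul_mem c hxJ⟩ = c • f ⟨x, hxJ⟩ := f.map_smul c ⟨x, hxJ⟩
    rw [this]
    exact J.smul_mem c (h hxJ)

/-- A fraction `c / d` that multiplies a strong ideal into `R` multiplies it into itself. -/
theorem IsStrong.mem_of_dvd [IsDomain R] {J : Ideal R} (hJ : IsStrong J) {c d : R} (hd : d ≠ 0)
    (h : ∀ j ∈ J, d ∣ c * j) {j k : R} (hj : j ∈ J) (hk : c * j = d * k) : k ∈ J := by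
  choose g hg using h
  let f : J →ₗ[R] R :=
    { toFun := fun j => g j j.2
      map_add' := fun x y => mul_left_cancel₀ hd (by
        rw [mul_add, ← hg, ← hg, ← hg, Submodule.coe_add, mul_add])
      map_smul' := fun r x => mul_left_cancel₀ hd (by
        rw [← hg, RingHom.id_apply, smul_eq_mul, mul_left_comm, ← hg, Submodule.coe_smul,
          smul_eq_mul, mul_left_comm]) }
  have hkf : k = f ⟨j, hj⟩ := mul_left_cancel₀ hd (hk.symm.trans (hg j hj))
  rw [hkf]
  exact hJ.mem_of_linearMap f ⟨j, hj⟩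

/-- An ideal stable under all linear forms on it is strong: it is its own trace. -/
theorem isStrong_of_forall_linearMap {J : Ideal R} (h : ∀ (f : J →ₗ[R] R) (j : J), f j ∈ J) :
    IsStrong J :=
  ⟨J, inferInstance, inferInstance, by
    refine le_antisymm (fun j hj => Ideal.subset_span ?_) (Ideal.span_le.2 ?_)
    · exact ⟨J.subtype, ⟨j, hj⟩, rfl⟩
    · rintro _ ⟨f, j, rfl⟩
      exact h f j⟩

/-! ### The trace property yields finitely generated supports -/

/-- In a P`v`MD the ideal `(d R : c)` is `v`-finite, so it has a finitely generated subideal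
contained in the same `t`-maximal ideals. The reason is that `(d R : c)` and `(c R : d)` are
contained in no common `t`-maximal ideal, so finitely many elements of their sum already have this
property. Since `(c R : d)` is `(d R : c)` multiplied by `c / d`, these elements involve only
finitely many elements of `(d R : c)`, which generate the required subideal. -/
theorem exists_fg_le_colon [IsDomain R] (hV : ∀ M : Ideal R, IsTMax M → IsLocVal M) (c : R) {d : R}
    (hd : d ≠ 0) :
    ∃ F : Ideal R, F.FG ∧ F ≤ (Ideal.span {d}).colon {c} ∧
      ∀ M, IsTMax M → F ≤ M → (Ideal.span {d}).colon {c} ≤ M := by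
  have memA : ∀ {x}, x ∈ (Ideal.span {d}).colon {c} ↔ d ∣ x * c := by
    simp [Ideal.mem_span_singleton]
  set A : Ideal R := (Ideal.span {d}).colon {c} with hA
  let B : Ideal R := (Ideal.span {c}).colon {d}
  have memB : ∀ {x}, x ∈ B ↔ c ∣ x * d := by
    simp [B, Ideal.mem_span_singleton]
  have hdA : d ∈ A := memA.2 (dvd_mul_right d c)
  have hAB : ∀ M, IsTMax M → ¬ A ⊔ B ≤ M := by
    intro M hM hle
    obtain ⟨s, hs, h | h⟩ := hV M hM c d
    · exact hs (hle (le_sup_left (a := A) (memA.2 h)))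
    · exact hs (hle (le_sup_right (a := A) (memB.2 h)))
  obtain ⟨H, hH, hHAB, hHM⟩ := exists_fg_le_not_le_isTMax
    (fun h => hd (by simpa [h] using (le_sup_left (a := A) (b := B)) hdA)) hAB
  suffices ∃ F : Ideal R, F.FG ∧ F ≤ A ∧
      ∀ M : Ideal R, M.IsPrime → F ≤ M → ¬ A ≤ M → H ≤ M by
    obtain ⟨F, hF, hFA, h⟩ := this
    exact ⟨F, hF, hFA, fun M hM hFM => by_contra fun hAM => hHM M hM (h M hM.isPrime hFM hAM)⟩
  clear hHM
  induction H, hH using Submodule.fg_induction with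
  | singleton x =>
    obtain ⟨a, ha, b, hb, rfl⟩ := Submodule.mem_sup.1 (hHAB (Ideal.mem_span_singleton_self x))
    obtain ⟨r, hr⟩ := memB.1 hb
    have hrA : r ∈ A := memA.2 ⟨b, by rw [mul_comm r, ← hr, mul_comm]⟩
    refine ⟨Ideal.span {a, r}, Submodule.fg_span (Set.toFinite _), Ideal.span_le.2 ?_, fun M hM hFM hAM => ?_⟩
    · rintro x (rfl | rfl)
      exacts [ha, hrA]
    · obtain ⟨a', ha', ha'M⟩ := SetLike.not_le_iff_exists.1 hAM
      obtain ⟨k, hk⟩ := memA.1 ha'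
      -- From `a' c = d k` and `b d = c r` it follows that `a' b = k r`.
      have hab : a' * b = k * r := mul_right_cancel₀ hd (by
        rw [mul_assoc, hr, ← mul_assoc, hk]; ring)
      have haM : a ∈ M := hFM (Ideal.subset_span (by simp))
      have hrM : r ∈ M := hFM (Ideal.subset_span (by simp))
      have hbM : b ∈ M := (hM.mem_or_mem (hab ▸ M.mul_mem_left k hrM)).resolve_left ha'M
      exact (Ideal.span_singleton_le_iff_mem M).2 (M.add_mem haM hbM)
  | sup N₁ N₂ _ _ h₁ h₂ =>
    obtain ⟨F₁, hF₁, hA₁, hM₁⟩ := h₁ (le_sup_left.trans hHAB)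
    obtain ⟨F₂, hF₂, hA₂, hM₂⟩ := h₂ (le_sup_right.trans hHAB)
    exact ⟨F₁ ⊔ F₂, Submodule.FG.sup hF₁ hF₂, sup_le hA₁ hA₂, fun M hM hFM hAM =>
      sup_le (hM₁ M hM (le_sup_left.trans hFM) hAM) (hM₂ M hM (le_sup_right.trans hFM) hAM)⟩

/-- If no finitely generated subideal of the branched prime `t`-ideal `P` cuts it out among the
`t`-maximal ideals, then the intersection of the localizations `R_M` at the `t`-maximal ideals
`M` not containing `P` is contained in `R_P`. This makes the `P`-primary ideal `a² R_P ∩ R`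
strong, where `P` is minimal over `a`; but it is not radical. -/
theorem isTSupportFG_of_trace [IsDomain R] (hV : ∀ M : Ideal R, IsTMax M → IsLocVal M)
    (h : ∀ J : Ideal R, J ≠ ⊤ → IsStrong J → IsTClosed J → J.IsRadical) {P : Ideal R}
    (hP : P.IsPrime) (hPT : IsTClosed P) (hB : IsBranched P) : IsTSupportFG P := by
  obtain ⟨a, ha⟩ := hB.exists_mem_minimalPrimes (isLocVal_of_isTClosed hV hP hPT)
  have haP : a ∈ P := ha.le (Ideal.mem_span_singleton_self a)
  have ha0 : a ≠ 0 := by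
    rintro rfl
    exact hPT.1 (le_bot_iff.1 (ha.2 ⟨Ideal.isPrime_bot, by simp⟩ bot_le))
  have hd : a ^ 2 ≠ 0 := pow_ne_zero 2 ha0
  have ha2 := minimalPrimes_span_sq a ▸ ha
  by_contra hcon
  set Q := saturation (Ideal.span {a ^ 2}) P
  have haQ : a ^ 2 ∈ Q := le_saturation (Ideal.mem_span_singleton_self _)
  have hQrad : Q.radical = P := radical_saturation ha2
  have hQ : Q.IsRadical := by
    refine h Q (isPrimary_saturation ha2).ne_top (isStrong_of_forall_linearMap fun f m => ?_)
      (isTClosed_saturation (isTClosed_span_singleton hd))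
    -- The form `f` is multiplication by the fraction `c / a ^ 2`.
    obtain ⟨c, hc⟩ : ∃ c, f ⟨a ^ 2, haQ⟩ = c := ⟨_, rfl⟩
    have hf : ∀ q : Q, a ^ 2 * f q = q * c := fun q => by
      have := (f.map_smul (a ^ 2) q).symm.trans ((congrArg f (Subtype.ext (mul_comm _ _))).trans
        (f.map_smul (q : R) ⟨a ^ 2, haQ⟩))
      rwa [hc] at this
    obtain ⟨F, hF, hFA, hFM⟩ := exists_fg_le_colon hV c hd
    have hAP : ¬ (Ideal.span {a ^ 2}).colon {c} ≤ P := fun hle =>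
      hcon ⟨F, hF, hFA.trans hle, fun M hM hPM hFM' => hPM <| by
        have hQM : Q ≤ M := fun q hq => hFM M hM hFM' (by
          simpa [Ideal.mem_span_singleton] using ⟨_, (hf ⟨q, hq⟩).symm⟩)
        rw [← hQrad]
        exact hM.isPrime.radical_le_iff.2 hQM⟩
    obtain ⟨s, hs, hsP⟩ := SetLike.not_le_iff_exists.1 hAP
    obtain ⟨k, hk⟩ : a ^ 2 ∣ s * c := by simpa [Ideal.mem_span_singleton] using hs
    have : s * f m = k * m := mul_left_cancel₀ hd (by
      rw [mul_left_comm, hf m, ← mul_assoc (a ^ 2), ← hk]; ring)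
    exact mem_saturation_of_mul_mem hsP (this ▸ Q.mul_mem_left k m.2)
  exact notMem_saturation_sq haP ha0 (hQ (hQrad.symm ▸ haP))

/-! ### Finitely generated supports yield the trace property -/

/-- Every proper strong `t`-ideal is radical if each branched prime `t`-ideal is cut out by a
finitely generated subideal. For `r` in the radical of `J` but not in `J`, take a `t`-maximal
`M ⊇ (J : r)` and the minimal prime `P ⊆ M` of `J`; it is minimal over `r`. Two suitable fractions
multiplying `J` into `R`, hence into `J`, show first `r ∈ J R_P` and then `r ∈ J R_M`. -/
theorem isRadical_of_isTSupportFG [IsDomain R] (hV : ∀ M : Ideal R, IsTMax M → IsLocVal M)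
    (h : ∀ P : Ideal R, P.IsPrime → IsTClosed P → IsBranched P → IsTSupportFG P) {J : Ideal R}
    (hJ : IsStrong J) (hJT : IsTClosed J) : J.IsRadical := by
  intro r hr
  by_contra hrJ
  have memC : ∀ {x}, x ∈ J.colon {r} ↔ x * r ∈ J := Submodule.mem_colon_singleton
  obtain ⟨M, hM, hCM⟩ := exists_isTMax_ge (hJT.colon {r}) (by simpa using hrJ)
  have hMp := hM.isPrime
  obtain ⟨P, hP, hPM⟩ := Ideal.exists_minimalPrimes_le (Ideal.le_colon.trans hCM)
  have hPp := hP.isPrime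
  have hPT := isTClosed_of_mem_minimalPrimes hJT hP
  have hPV : IsLocVal P := (hV M hM).mono hPM
  have hrP : r ∈ P := hPp.radical_le_iff.2 hP.le hr
  have hr0 : r ≠ 0 := fun h0 => hrJ (h0 ▸ J.zero_mem)
  have hPr : P ∈ (Ideal.span {r}).minimalPrimes := by
    refine ⟨⟨hPp, (Ideal.span_singleton_le_iff_mem P).2 hrP⟩, fun Q hQ hQP => ?_⟩
    refine hP.2 ⟨hQ.1, fun j hj => ?_⟩ hQP
    obtain ⟨s, hs, hd | hd⟩ := hV M hM r j
    · exact absurd (hCM (memC.2 (J.mem_of_dvd hd hj))) hs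
    · exact (hQ.1.mem_or_mem (Q.mem_of_dvd hd ((Ideal.span_singleton_le_iff_mem Q).1 hQ.2))
        ).resolve_left fun hsQ => hs (hPM (hQP hsQ))
  obtain ⟨I, hI, hIP, hIM⟩ := h P hPp hPT (isBranched_of_mem_minimalPrimes hr0 hPr)
  have hIN : ∀ N, IsTMax N → ¬ P ≤ N → ∃ i ∈ I, i ∉ N := fun N hN hPN =>
    SetLike.not_le_iff_exists.1 (hIM N hN hPN)
  obtain ⟨s, hs, hsr⟩ : ∃ s ∉ P, s * r ∈ J := by
    by_contra! hcon
    -- A local generator `q` at `P` of `I + r R` yields the fraction `s / q`.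
    obtain ⟨q, hq, s, hs, hsq⟩ := hPV.exists_generator_of_fg
      (Submodule.FG.sup hI (Submodule.fg_span_singleton r))
    have hrI : r ∈ I ⊔ Ideal.span {r} :=
      le_sup_right (a := I) (Ideal.mem_span_singleton_self r)
    have hqJ : ∀ t ∉ P, t * q ∉ J := fun t ht htq => by
      obtain ⟨k, hk⟩ := hsq r hrI
      refine hcon (t * s) (fun h => (hPp.mem_or_mem h).elim ht hs) ?_
      rw [mul_assoc, hk, ← mul_assoc]
      exact J.mul_mem_right k htq
    have hqP : q ∈ P :=
      (sup_le hIP ((Ideal.span_singleton_le_iff_mem P).2 hrP) : I ⊔ Ideal.span {r} ≤ P) hq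
    have hq0 : q ≠ 0 := fun h0 => hqJ 1 hPp.one_notMem (by simp [h0])
    have hsJ : ∀ j ∈ J, q ∣ s * j := fun j hj => dvd_of_forall_isTMax hq0 fun N hN => by
      have := hN.isPrime
      by_cases hPN : P ≤ N
      · obtain ⟨q', hq', t, ht, htq'⟩ := (hV N hN).exists_generator_of_fg
          (Submodule.FG.sup hI (Submodule.fg_span_singleton r))
        obtain ⟨u, hu, hd | hd⟩ := hV N hN j q'
        · refine ⟨u, hu, ?_⟩
          rw [mul_left_comm]
          exact (hsq q' hq').trans (mul_dvd_mul_left s hd)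
        · refine absurd ?_ (hqJ (u * t)
            fun h => (hPp.mem_or_mem h).elim (fun h => hu (hPN h)) fun h => ht (hPN h))
          refine J.mem_of_dvd ?_ hj
          rw [mul_assoc]
          exact hd.trans (mul_dvd_mul_left u (htq' q hq))
      · obtain ⟨i, hi, hiN⟩ := hIN N hN hPN
        refine ⟨i, hiN, ?_⟩
        rw [← mul_assoc, mul_comm i]
        exact (hsq i (le_sup_left (a := I) hi)).mul_right j
    -- Dividing repeatedly by `q / s`, an element `t * q ^ n` of `J` turns into one outside `P`.
    obtain ⟨t, ht, n, hn⟩ := exists_mul_pow_mem_of_mem_minimalPrimes hP hqP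
    suffices ∀ n : ℕ, ∀ t ∉ P, t * q ^ n ∉ J from this n t ht hn
    intro n
    induction n with
    | zero => exact fun t ht h => ht (hP.le (by simpa using h))
    | succ n ih =>
      exact fun t ht h => ih (s * t) (fun h => (hPp.mem_or_mem h).elim hs ht)
        (hJ.mem_of_dvd hq0 hsJ h (by ring))
  have hs0 : s ≠ 0 := fun h0 => hs (h0 ▸ P.zero_mem)
  -- Locally at `M` the ideal `I + s R` is generated by `s`, which yields the fraction `t / s`.
  obtain ⟨t, ht, htI⟩ : ∃ t ∉ M, ∀ i ∈ I, s ∣ t * i := by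
    obtain ⟨q, hq, v, hv, hvq⟩ := (hV M hM).exists_generator_of_fg hI
    obtain ⟨u, hu, hd | hd⟩ := hV M hM q s
    · refine ⟨u * v, fun h => (hMp.mem_or_mem h).elim hu hv, fun i hi => ?_⟩
      rw [mul_assoc]
      exact hd.trans (mul_dvd_mul_left u (hvq i hi))
    · exact absurd (hPp.mem_or_mem (P.mem_of_dvd hd (hIP hq)))
        (not_or.2 ⟨fun h => hu (hPM h), hs⟩)
  have htJ : ∀ j ∈ J, s ∣ t * j := fun j hj => dvd_of_forall_isTMax hs0 fun N hN => by
    by_cases hPN : P ≤ N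
    · obtain ⟨u, hu, hd | hd⟩ := hV N hN j s
      · refine ⟨u, hu, ?_⟩
        rw [mul_left_comm]
        exact hd.mul_left t
      · exact absurd (hPp.mem_or_mem (P.mem_of_dvd hd (hP.le hj)))
          (not_or.2 ⟨fun h => hu (hPN h), hs⟩)
    · obtain ⟨i, hi, hiN⟩ := hIN N hN hPN
      refine ⟨i, hiN, ?_⟩
      rw [← mul_assoc, mul_comm i]
      exact (htI i hi).mul_right j
  exact ht (hCM (memC.2 (hJ.mem_of_dvd hs0 htJ hsr (by ring))))

/-! ### Finiteness of the sets of minimal prime `t`-ideals -/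

/-- A branched prime `t`-ideal `P` cut out by `J ⊆ P` and minimal over `a` is the radical of the
divisorial closure of `J + a R`. -/
theorem IsTSupportFG.exists_radical_eq [IsDomain R]
    (hV : ∀ M : Ideal R, IsTMax M → IsLocVal M) {P : Ideal R} (hP : P.IsPrime) (hPT : IsTClosed P)
    (hB : IsBranched P) (h : IsTSupportFG P) :
    ∃ F : Ideal R, F.FG ∧ F ≠ ⊥ ∧ P = (idealV F).radical := by
  obtain ⟨a, ha⟩ := hB.exists_mem_minimalPrimes (isLocVal_of_isTClosed hV hP hPT)
  have haP := ha.le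
  have ha0 : a ≠ 0 := by
    rintro rfl
    exact hPT.1 (le_bot_iff.1 (ha.2 ⟨Ideal.isPrime_bot, by simp⟩ bot_le))
  obtain ⟨J, hJ, hJP, hJM⟩ := h
  have hF : (J ⊔ Ideal.span {a}).FG := Submodule.FG.sup hJ (Submodule.fg_span_singleton a)
  have hF0 : J ⊔ Ideal.span {a} ≠ ⊥ := fun h => ha0 (by
    simpa using le_bot_iff.1 (le_sup_right.trans h.le))
  refine ⟨_, hF, hF0, le_antisymm ?_ ?_⟩
  · rw [← Ideal.sInf_minimalPrimes]
    refine le_sInf fun Q hQ => ?_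
    have hQp := hQ.isPrime
    have hFQ := (le_idealV _).trans hQ.le
    obtain ⟨M, hM, hQM⟩ := exists_isTMax_ge
      (isTClosed_of_mem_minimalPrimes (isTClosed_idealV hF0) hQ) hQp.ne_top
    have hPM : P ≤ M := by_contra fun hPM => hJM M hM hPM (le_sup_left.trans (hFQ.trans hQM))
    rcases (hV M hM).le_total hPM hQM with hle | hle
    · exact hle
    · exact ha.2 ⟨hQp, le_sup_right.trans hFQ⟩ hle
  · exact hP.radical_le_iff.2 (hPT.2 _ hF (sup_le hJP haP))

theorem finite_tMinimalPrimes_of_radical [IsDomain R]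
    (h : ∀ P : Ideal R, P.IsPrime → IsTClosed P → IsBranched P →
      ∃ F : Ideal R, F.FG ∧ F ≠ ⊥ ∧ P = (idealV F).radical) {x : R} (hx : x ≠ 0) :
    (tMinimalPrimes (Ideal.span {x})).Finite := by
  have hxT := isTClosed_span_singleton hx
  rw [tMinimalPrimes_eq_minimalPrimes hxT]
  obtain ⟨G, hG, hGx⟩ := exists_mem_closure_le
    (𝓕 := {F | F.FG ∧ (idealV F).radical ∈ (Ideal.span {x}).minimalPrimes})
    (fun F hF => hF.1) hxT (fun Q hQ _ hxQ => by
      obtain ⟨P, hP, hPQ⟩ := Ideal.exists_minimalPrimes_le hxQ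
      obtain ⟨F, hF, -, hPF⟩ := h P hP.isPrime (isTClosed_of_mem_minimalPrimes hxT hP)
        (isBranched_of_mem_minimalPrimes hx hP)
      exact ⟨F, ⟨hF, hPF ▸ hP⟩, ((le_idealV F).trans Ideal.le_radical).trans (hPF ▸ hPQ)⟩)
  -- Each minimal prime contains one of the finitely many factors of `G`, hence is its radical.
  suffices {P | P ∈ (Ideal.span {x}).minimalPrimes ∧ G ≤ P}.Finite from
    this.subset fun P hP => ⟨hP, hGx.trans hP.le⟩
  clear hGx
  induction hG using Submonoid.closure_induction with
  | mem F hF =>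
    refine (Set.finite_singleton (idealV F).radical).subset fun P hP => ?_
    have hPT := isTClosed_of_mem_minimalPrimes hxT hP.1
    have hle : (idealV F).radical ≤ P := hP.1.isPrime.radical_le_iff.2 (hPT.2 F hF.1 hP.2)
    exact (le_antisymm hle (hP.1.2 hF.2.1 hle)).symm
  | one =>
    refine Set.finite_empty.subset fun P hP => hP.1.isPrime.ne_top ?_
    simpa using hP.2
  | mul F G _ _ hF hG =>
    exact (hF.union hG).subset fun P hP =>
      (hP.1.isPrime.mul_le.1 hP.2).imp (⟨hP.1, ·⟩) (⟨hP.1, ·⟩)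

theorem exists_fg_le_of_le_sup {A B H : Ideal R} (hH : H.FG) (h : H ≤ A ⊔ B) :
    ∃ F : Ideal R, F.FG ∧ F ≤ A ∧ H ≤ F ⊔ B := by
  induction H, hH using Submodule.fg_induction with
  | singleton x =>
    obtain ⟨a, ha, b, hb, rfl⟩ := Submodule.mem_sup.1 (h (Ideal.mem_span_singleton_self x))
    exact ⟨Ideal.span {a}, Submodule.fg_span_singleton a, (Ideal.span_singleton_le_iff_mem A).2 ha,
      (Ideal.span_singleton_le_iff_mem _).2
        (Submodule.add_mem_sup (Ideal.mem_span_singleton_self a) hb)⟩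
  | sup N₁ N₂ _ _ h₁ h₂ =>
    obtain ⟨F₁, hF₁, hA₁, hN₁⟩ := h₁ (le_sup_left.trans h)
    obtain ⟨F₂, hF₂, hA₂, hN₂⟩ := h₂ (le_sup_right.trans h)
    exact ⟨F₁ ⊔ F₂, Submodule.FG.sup hF₁ hF₂, sup_le hA₁ hA₂,
      sup_le (hN₁.trans (sup_le_sup_right le_sup_left B))
        (hN₂.trans (sup_le_sup_right le_sup_right B))⟩

/-- If `P` is minimal over `a` and `a` has finitely many minimal primes `Q`, then `P` is cut out by
a finitely generated ideal that contains `a` and, for each `Q ≠ P`, a part of `P` that is contained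
in no common `t`-maximal ideal with `Q`. -/
theorem isTSupportFG_of_finite [IsDomain R] (hV : ∀ M : Ideal R, IsTMax M → IsLocVal M)
    (h : ∀ x : R, x ≠ 0 → (tMinimalPrimes (Ideal.span {x})).Finite) {P : Ideal R}
    (hP : P.IsPrime) (hPT : IsTClosed P) (hB : IsBranched P) : IsTSupportFG P := by
  obtain ⟨a, ha⟩ := hB.exists_mem_minimalPrimes (isLocVal_of_isTClosed hV hP hPT)
  have ha0 : a ≠ 0 := by
    rintro rfl
    exact hPT.1 (le_bot_iff.1 (ha.2 ⟨Ideal.isPrime_bot, by simp⟩ bot_le))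
  have hfin := h a ha0
  rw [tMinimalPrimes_eq_minimalPrimes (isTClosed_span_singleton ha0)] at hfin
  have hsep : ∀ Q ∈ (Ideal.span {a}).minimalPrimes, ∃ F : Ideal R, F.FG ∧ F ≤ P ∧
      (Q ≠ P → ∀ M, IsTMax M → ¬ F ⊔ Q ≤ M) := by
    intro Q hQ
    by_cases hQP : Q = P
    · exact ⟨⊥, Submodule.fg_bot, bot_le, fun h => absurd hQP h⟩
    have := hQ.isPrime
    obtain ⟨H, hH, hHPQ, hHM⟩ := exists_fg_le_not_le_isTMax (I := P ⊔ Q)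
      (fun h => hPT.1 (le_bot_iff.1 (le_sup_left.trans h.le))) fun M hM hle => by
        rcases (hV M hM).le_total (le_sup_left.trans hle) (le_sup_right.trans hle) with hl | hl
        · exact hQP (le_antisymm (hQ.2 ha.1 hl) hl)
        · exact hQP (le_antisymm hl (ha.2 hQ.1 hl))
    obtain ⟨F, hF, hFP, hHF⟩ := exists_fg_le_of_le_sup hH hHPQ
    exact ⟨F, hF, hFP, fun _ M hM hle => hHM M hM (hHF.trans hle)⟩
  choose! F hF hFP hFM using hsep
  refine ⟨Ideal.span {a} ⊔ hfin.toFinset.sup F, Submodule.FG.sup (Submodule.fg_span_singleton a)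
    (Submodule.fg_finset_sup _ _ fun Q hQ => hF Q (hfin.mem_toFinset.1 hQ)),
    sup_le ha.le (Finset.sup_le fun Q hQ => hFP Q (hfin.mem_toFinset.1 hQ)),
    fun M hM hPM hle => ?_⟩
  have := hM.isPrime
  obtain ⟨Q, hQ, hQM⟩ := Ideal.exists_minimalPrimes_le (le_sup_left.trans hle)
  refine hFM Q hQ (fun hQP => hPM (hQP ▸ hQM)) M hM (sup_le ?_ hQM)
  exact (Finset.le_sup (hfin.mem_toFinset.2 hQ)).trans (le_sup_right.trans hle)

/-- Each minimal prime `t`-ideal of a finitely generated ideal is one of a local generator. -/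
theorem finite_tMinimalPrimes_of_fg [IsDomain R] (hV : ∀ M : Ideal R, IsTMax M → IsLocVal M)
    (h : ∀ x : R, x ≠ 0 → (tMinimalPrimes (Ideal.span {x})).Finite) {J : Ideal R} (hJ : J.FG)
    (hJ0 : J ≠ ⊥) : (tMinimalPrimes J).Finite := by
  obtain ⟨S, rfl⟩ := hJ
  have hS : S.Nonempty := Finset.nonempty_iff_ne_empty.2 fun h => hJ0 (by simp [h])
  refine (S.finite_toSet.biUnion (t := fun x => {P | x ≠ 0 ∧ P ∈ tMinimalPrimes (Ideal.span {x})})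
    fun x _ => ?_).subset ?_
  · by_cases hx : x = 0
    · simp [hx]
    · exact (h x hx).subset fun P hP => hP.2
  · rintro P ⟨⟨⟨hP, hPT⟩, hSP⟩, hmin⟩
    have hPV := isLocVal_of_isTClosed hV hP hPT
    obtain ⟨q, hq, s, hs, hsq⟩ := hPV.exists_generator hS
    have hle : ∀ Q : Ideal R, Q.IsPrime → Q ≤ P → q ∈ Q → Ideal.span (S : Set R) ≤ Q :=
      fun Q hQ hQP hqQ i hi => (hQ.mem_or_mem (Q.mem_of_dvd (hsq i hi) hqQ)).resolve_left
        fun h => hs (hQP h)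
    have hq0 : q ≠ 0 := by
      rintro rfl
      exact hJ0 (le_bot_iff.1 (hle ⊥ Ideal.isPrime_bot bot_le rfl))
    refine Set.mem_biUnion hq ⟨hq0, ⟨⟨hP, hPT⟩, ?_⟩, fun Q hQ hQP => ?_⟩
    · exact (Ideal.span_singleton_le_iff_mem P).2 (hSP (Ideal.subset_span hq))
    · exact hmin ⟨hQ.1, hle Q hQ.1.1 hQP ((Ideal.span_singleton_le_iff_mem Q).1 hQ.2)⟩ hQP

/-! ### Comparison with the closures in the quotient field -/

section Comparison

variable (K : Type*) [Field K] [Algebra R K]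

open IsLocalization (coeSubmodule)

theorem vClosure_one : vClosure (1 : Submodule R K) = 1 := by
  refine le_antisymm (fun x hx => ?_) fun x hx => ?_
  · rw [vClosure, Submodule.mem_div_iff_forall_mul_mem] at hx
    simpa using hx 1 (by rw [Submodule.mem_div_iff_forall_mul_mem]; simp)
  · rw [vClosure, Submodule.mem_div_iff_forall_mul_mem]
    intro y hy
    rw [mul_comm]
    exact Submodule.mem_div_iff_forall_mul_mem.1 hy x hx

variable [IsFractionRing R K]

theorem algebraMap_mem_vClosure_coeSubmodule [IsDomain R] (F : Ideal R) (x : R) :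
    algebraMap R K x ∈ vClosure (coeSubmodule K F) ↔ x ∈ idealV F := by
  have key : ∀ c d y : R, d ≠ 0 →
      (algebraMap R K c / algebraMap R K d * algebraMap R K y ∈ (1 : Submodule R K) ↔
        d ∣ c * y) := by
    intro c d y hd
    have hd' : algebraMap R K d ≠ 0 := by simpa using hd
    rw [Submodule.mem_one]
    refine exists_congr fun z => ?_
    rw [div_mul_eq_mul_div, eq_div_iff hd', ← map_mul, ← map_mul,
      (IsFractionRing.injective R K).eq_iff, mul_comm z, eq_comm]
  simp only [vClosure, Submodule.mem_div_iff_forall_mul_mem, mem_idealV]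
  constructor
  · intro h c d hd hF
    rw [← key c d x hd, mul_comm]
    refine h _ ?_
    rintro _ ⟨f, hf, rfl⟩
    exact (key c d f hd).2 (hF f hf)
  · intro h y hy
    obtain ⟨c, d, hd, rfl⟩ := IsFractionRing.div_surjective R y
    have hd0 := nonZeroDivisors.ne_zero hd
    rw [mul_comm, key c d x hd0]
    exact h c d hd0 fun f hf => (key c d f hd0).1 (hy _ ⟨f, hf, rfl⟩)

theorem vClosure_coeSubmodule [IsDomain R] (F : Ideal R) :
    vClosure (coeSubmodule K F) = coeSubmodule K (idealV F) := by
  ext x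
  constructor
  · intro hx
    have hx1 : x ∈ (1 : Submodule R K) := by
      rw [← vClosure_one K, ← IsLocalization.coeSubmodule_top (R := R) K]
      exact vClosure_mono (IsLocalization.coeSubmodule_mono K le_top) hx
    obtain ⟨r, rfl⟩ := Submodule.mem_one.1 hx1
    exact ⟨r, (algebraMap_mem_vClosure_coeSubmodule K F r).1 hx, rfl⟩
  · rintro ⟨r, hr, rfl⟩
    exact (algebraMap_mem_vClosure_coeSubmodule K F r).2 hr

theorem exists_eq_coeSubmodule_of_le {F : Submodule R K} {I : Ideal R}
    (h : F ≤ coeSubmodule K I) : ∃ G : Ideal R, G ≤ I ∧ F = coeSubmodule K G := by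
  refine ⟨F.comap (Algebra.linearMap R K), fun x hx => ?_, ?_⟩
  · obtain ⟨y, hy, hxy⟩ := h hx
    exact IsFractionRing.injective R K hxy ▸ hy
  · refine (Submodule.map_comap_eq_of_le fun x hx => ?_).symm
    obtain ⟨y, -, rfl⟩ := h hx
    exact ⟨y, rfl⟩

theorem isTIdeal_iff [IsDomain R] (I : Ideal R) : IsTIdeal K I ↔ IsTClosed I := by
  refine and_congr_right fun _ => ⟨fun h F hF hFI x hx => ?_, fun h => le_antisymm ?_ ?_⟩
  · have : algebraMap R K x ∈ tClosure (coeSubmodule K I) :=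
      ⟨coeSubmodule K F, (IsLocalization.coeSubmodule_fg K (IsFractionRing.injective R K) F).2 hF,
        IsLocalization.coeSubmodule_mono K hFI,
        (algebraMap_mem_vClosure_coeSubmodule K F x).2 hx⟩
    obtain ⟨y, hy, hxy⟩ := h ▸ this
    exact IsFractionRing.injective R K hxy ▸ hy
  · rintro x ⟨F, hF, hFI, hx⟩
    obtain ⟨G, hGI, rfl⟩ := exists_eq_coeSubmodule_of_le K hFI
    rw [IsLocalization.coeSubmodule_fg K (IsFractionRing.injective R K)] at hF
    rw [vClosure_coeSubmodule] at hx
    exact IsLocalization.coeSubmodule_mono K (h G hF hGI) hx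
  · rintro _ ⟨x, hx, rfl⟩
    refine ⟨coeSubmodule K (Ideal.span {x}), ?_, ?_, ?_⟩
    · exact (IsLocalization.coeSubmodule_fg K (IsFractionRing.injective R K) _).2
        (Submodule.fg_span_singleton x)
    · exact IsLocalization.coeSubmodule_mono K ((Ideal.span_singleton_le_iff_mem I).2 hx)
    · exact (algebraMap_mem_vClosure_coeSubmodule K _ x).2
        (le_idealV _ (Ideal.mem_span_singleton_self x))

theorem isTMaximal_iff [IsDomain R] (M : Ideal R) : IsTMaximal K M ↔ IsTMax M := by
  simp only [IsTMaximal, IsTMax, isTIdeal_iff]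

theorem isTPrime_iff [IsDomain R] (P : Ideal R) : IsTPrime K P ↔ P.IsPrime ∧ IsTClosed P := by
  rw [IsTPrime, isTIdeal_iff]

theorem minimalTPrimes_eq [IsDomain R] (J : Ideal R) : minimalTPrimes K J = tMinimalPrimes J := by
  simp only [minimalTPrimes, tMinimalPrimes, isTPrime_iff]

/-- A `v`-finite divisorial ideal is the divisorial closure of a finitely generated integral
ideal: the fractional ideal of which it is the closure is contained in it. -/
theorem isDivisorial_and_isVFinite_iff [IsDomain R] (I : Ideal R) :
    IsDivisorial K I ∧ IsVFinite K I ↔ ∃ F : Ideal R, F.FG ∧ F ≠ ⊥ ∧ I = idealV F := by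
  have hinj := IsLocalization.coeSubmodule_injective K (le_refl (nonZeroDivisors R))
  constructor
  · rintro ⟨⟨-, hI⟩, F, hF0, hF, hIF⟩
    have hFI : F ≤ coeSubmodule K I := by
      rw [← hI, hIF]
      intro x hx
      rw [vClosure, Submodule.mem_div_iff_forall_mul_mem]
      intro y hy
      rw [mul_comm]
      exact Submodule.mem_div_iff_forall_mul_mem.1 hy x hx
    obtain ⟨G, -, rfl⟩ := exists_eq_coeSubmodule_of_le K hFI
    refine ⟨G, (IsLocalization.coeSubmodule_fg K (IsFractionRing.injective R K) G).1 hF, ?_, ?_⟩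
    · rintro rfl
      exact hF0 (IsLocalization.coeSubmodule_bot K)
    · exact hinj (by rw [← vClosure_coeSubmodule, ← hIF, hI])
  · rintro ⟨F, hF, hF0, rfl⟩
    refine ⟨⟨idealV_ne_bot hF0, by rw [vClosure_coeSubmodule, idealV_idem]⟩, coeSubmodule K F,
      fun h => hF0 (hinj (h.trans (IsLocalization.coeSubmodule_bot K).symm)),
      (IsLocalization.coeSubmodule_fg K (IsFractionRing.injective R K) F).2 hF, ?_⟩
    rw [vClosure_coeSubmodule, vClosure_coeSubmodule, idealV_idem]

end Comparison

end TStar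

/-! ### The equivalences -/

/-- Characterizations of the `t`-radical trace property of a PvMD `R` with quotient field `K`,
`R ≠ K`.  The fourth and the sixth condition occur twice, once for minimal primes and once for
minimal `t`-primes. -/
theorem mainTheorem1 {R : Type*} [CommRing R] [IsDomain R] (hR : ¬ IsField R)
    (K : Type*) [Field K] [Algebra R K] [IsFractionRing R K] (hP : TStar.IsPvMD R K) :
    List.TFAE
      [ TStar.IsTRTP R K,
        ∀ P : Ideal R, TStar.IsTPrime K P → TStar.IsBranched P →
          ∃ J : Ideal R, J.FG ∧ J ≤ P ∧
            ∀ M : Ideal R, TStar.IsTMaximal K M → ¬ P ≤ M → ¬ J ≤ M,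
        ∀ P : Ideal R, TStar.IsTPrime K P → TStar.IsBranched P →
          ∃ I : Ideal R, TStar.IsDivisorial K I ∧ TStar.IsVFinite K I ∧ P = I.radical,
        ∀ x : R, x ≠ 0 → (Ideal.span {x}).minimalPrimes.Finite,
        ∀ x : R, x ≠ 0 → (TStar.minimalTPrimes K (Ideal.span {x})).Finite,
        ∀ J : Ideal R, J ≠ ⊥ → J.FG → (TStar.minimalTPrimes K J).Finite,
        ∀ I : Ideal R, TStar.IsDivisorial K I → TStar.IsVFinite K I →
          I.minimalPrimes.Finite,
        ∀ I : Ideal R, TStar.IsDivisorial K I → TStar.IsVFinite K I →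
          (TStar.minimalTPrimes K I).Finite ] := by
  have hV : ∀ M : Ideal R, TStar.IsTMax M → TStar.IsLocVal M := fun M hM => by
    have := hM.isPrime
    have := hP M ((TStar.isTMaximal_iff K M).2 hM)
    exact TStar.isLocVal_of_valuationRing
  simp only [TStar.IsTRTP, ← and_imp (b := TStar.IsVFinite K _), ← and_assoc (b := TStar.IsVFinite K _),
    TStar.isDivisorial_and_isVFinite_iff,
    TStar.isTIdeal_iff, TStar.isTPrime_iff, TStar.isTMaximal_iff, TStar.minimalTPrimes_eq]
  tfae_have 1 → 2 := fun h P hP hB => TStar.isTSupportFG_of_trace hV h hP.1 hP.2 hB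
  tfae_have 2 → 1 := fun h J _ hJ hJT =>
    TStar.isRadical_of_isTSupportFG hV (fun P hP hPT hB => h P ⟨hP, hPT⟩ hB) hJ hJT
  tfae_have 2 → 3 := fun h P hP hB => by
    obtain ⟨F, hF, hF0, hPF⟩ := TStar.IsTSupportFG.exists_radical_eq hV hP.1 hP.2 hB (h P hP hB)
    exact ⟨_, ⟨F, hF, hF0, rfl⟩, hPF⟩
  tfae_have 3 → 5 := fun h x hx =>
    TStar.finite_tMinimalPrimes_of_radical (fun P hP hPT hB => by
      obtain ⟨_, ⟨F, hF, hF0, rfl⟩, hPF⟩ := h P ⟨hP, hPT⟩ hB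
      exact ⟨F, hF, hF0, hPF⟩) hx
  tfae_have 5 → 2 := fun h P hP hB => TStar.isTSupportFG_of_finite hV h hP.1 hP.2 hB
  tfae_have 4 ↔ 5 := forall₂_congr fun x hx => by
    rw [TStar.tMinimalPrimes_eq_minimalPrimes (TStar.isTClosed_span_singleton hx)]
  tfae_have 5 → 6 := fun h J hJ0 hJ => TStar.finite_tMinimalPrimes_of_fg hV h hJ hJ0
  tfae_have 6 → 8 := by
    rintro h _ ⟨F, hF, hF0, rfl⟩
    rw [TStar.tMinimalPrimes_idealV hF]
    exact h F hF0 hF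
  tfae_have 8 → 5 := fun h x hx => h _ ⟨Ideal.span {x}, Submodule.fg_span_singleton x,
    by simpa using hx, (TStar.idealV_span_singleton hx).symm⟩
  tfae_have 7 ↔ 8 := forall₂_congr fun I hI => by
    obtain ⟨F, hF, hF0, rfl⟩ := hI
    rw [TStar.tMinimalPrimes_eq_minimalPrimes (TStar.isTClosed_idealV hF0)]
  tfae_finish
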